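/- Let $\Sigma=\{(x,y)\in\mathbb{R}^2 : y=0\}$ and $\Sigma^+=\{(x,y)\in\mathbb{R}^2 : y\ge 0\}$, and let $Z^+=(P,Q)$ be a (real) analytic vector field on $\Sigma^+$. Suppose that the origin is an invisible contact of even multiplicity $2k$, $k\ge 1$, between $Z^+$ and $\Sigma$; that is, writing $h(x,y)=y$ and $Z^+f=\langle\nabla f,Z^+\rangle$ for the Lie derivative, $(Z^+)^ih(0,0)=0$ for $0\le i<2k$ and $(Z^+)^{2k}h(0,0)<0$. Then there is $x_0>0$ such that for every $x\in(0,x_0)$ there are a unique time $\tau^+(x)\neq0$ (positive or negative) and a unique point $(\varphi^+(x),0)\in\Sigma$ for which the solution of $Z^+$ with initial condition $(x,0)$ at time $0$ reaches $(\varphi^+(x),0)$ at time $\tau^+(x)$ and lies in $\Sigma^+\setminus\Sigma$ at all times strictly between $0$ and $\tau^+(x)$; moreover $\varphi^+(x)<0$. The half-return map $\varphi^+$ and the flight time $\tau^+$ extend to analytic functions on $(-x_0,x_0)$, given there by convergent power series \[ \varphi^+(x)=-x-\sum_{i\ge 2}\alpha_i x^i,\qquad \tau^+(x)=\hat T_0x+\sum_{i\ge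 1}\hat T_i x^{i+1}, \] with $\hat T_0\,P(0,0)<0$. -/

import Mathlib

open Set

namespace HalfMonodromy

/-- The switching line `Σ = {y = 0}` of the plane. -/
def switchingLine : Set (ℝ × ℝ) := {p | p.2 = 0}

/-- The closed upper half-plane `Σ⁺ = {y ≥ 0}`, the domain of the upper vector field. -/
def upperHalf : Set (ℝ × ℝ) := {p | 0 ≤ p.2}

/-- The Lie derivative `Z h = ⟨∇h, Z⟩` on `Σ⁺` of a function `h` along the vector field `Z`.
Derivatives are taken within `Σ⁺`, so that values of `Z` and `h` off `Σ⁺` play no role. -/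
noncomputable def lieDeriv (Z : ℝ × ℝ → ℝ × ℝ) (h : ℝ × ℝ → ℝ) : ℝ × ℝ → ℝ :=
  fun p => fderivWithin ℝ h upperHalf p (Z p)

/-- `Z` has a contact of multiplicity `n` with `Σ` at `p`: with `h (x, y) = y`, the iterated Lie
derivatives `Zⁱ h` vanish at `p` for `i < n` and `Zⁿ h` does not. Here `Zⁱ h` at `p` is the `i`-th
time derivative of the height `y` along the orbit through `p`. -/
def HasContact (Z : ℝ × ℝ → ℝ × ℝ) (p : ℝ × ℝ) (n : ℕ) : Prop :=
  (∀ i < n, (lieDeriv Z)^[i] Prod.snd p = 0) ∧ (lieDeriv Z)^[n] Prod.snd p ≠ 0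

/-- An invisible contact of even multiplicity `2 k` (with `k ≥ 1`): the orbit through `p` (of `Z`
continued analytically across `Σ`) lies
locally in `{y < 0}` apart from `p` itself, i.e. the first nonzero Lie derivative is negative. -/
def HasInvisibleEvenContact (Z : ℝ × ℝ → ℝ × ℝ) (p : ℝ × ℝ) (k : ℕ) : Prop :=
  1 ≤ k ∧ HasContact Z p (2 * k) ∧ (lieDeriv Z)^[2 * k] Prod.snd p < 0

/-- The orbit of `Z` through `(x, 0)` makes a half-turn in `Σ⁺` of (signed) flight time `τ` and
lands at `(ξ, 0)`: there is a solution between the times `0` and `τ` (`τ` of either sign) which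
joins `(x, 0)` to `(ξ, 0)` and lies in `Σ⁺ \ Σ` at all times strictly in between. -/
def IsHalfReturn (Z : ℝ × ℝ → ℝ × ℝ) (x τ ξ : ℝ) : Prop :=
  τ ≠ 0 ∧ ∃ γ : ℝ → ℝ × ℝ, γ 0 = (x, 0) ∧ γ τ = (ξ, 0) ∧
    (∀ t ∈ uIcc 0 τ, HasDerivWithinAt γ (Z (γ t)) (uIcc 0 τ) t) ∧
    ∀ t ∈ uIoo 0 τ, γ t ∈ upperHalf \ switchingLine

end HalfMonodromy

/-! Near the origin `Z` continues to an analytic field `g`. Label its orbits by their height `c` on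
the vertical axis at time `0`, and let `Ψ (t, c)` be the flow started at `(0, c)`. Since the height
of `Ψ (0, c)` is `c`, the implicit function theorem solves `(Ψ (t, c)).2 = 0` by an analytic `c = C
t`: the orbit lying on Σ at time `t` is the one labelled `C t` (`exists_zero_curve`).

The contact condition makes the height of the orbit through the origin equal to `t ^ (2 * k) * v t`
with `v 0 < 0` (`exists_height_eq_pow_mul`). As `C` is comparable to minus this height, `C = σ ^ (2
* k)` for a local analytic coordinate `σ`. An orbit therefore crosses Σ at two times with opposite
values of `σ`, exchanged by an analytic involution `j` with `j'(0) = -1`. The abscissa `X t` of the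
crossing satisfies `X'(0) = P(0,0) ≠ 0`, so it has an analytic inverse `r`. Then `φ = X ∘ j ∘ r` and
`τ = j ∘ r - r` are analytic, with `φ'(0) = -1` and `τ'(0) = -2 / P(0,0)`.

At time `u` the height on the orbit `c` has the sign of `c - C u`: positive between the two
crossings, negative just outside. With uniqueness for the differential equation this leaves no other
half-return (`isHalfReturn_iff`). The analytic flow itself comes from the implicit function theorem
in a Banach space of curves. -/

namespace HalfMonodromy

open Filter Topology
open scoped ContDiff NNReal

/-! ### Analytic composition operators on spaces of continuous functions. -/

section Nemytskii

variable {X E F : Type*} [TopologicalSpace X] [CompactSpace X]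
  [NormedAddCommGroup E] [NormedSpace ℝ E] [NormedAddCommGroup F] [NormedSpace ℝ F]

/-- The pointwise action of a continuous multilinear map on continuous functions. -/
noncomputable def pointwiseMultilinear {n : ℕ} (p : E [×n]→L[ℝ] F) :
    C(X, E) [×n]→L[ℝ] C(X, F) :=
  MultilinearMap.mkContinuous
    { toFun := fun m => ⟨fun t => p fun i => m i t, by fun_prop⟩
      map_update_add' := by
        intro _ m i a b
        ext t
        have key (c : C(X, E)) : (fun j => (Function.update m i c) j t) =
            Function.update (fun j => m j t) i (c t) := by
          ext j
          by_cases h : j = i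
          · subst h; simp
          · simp [h]
        simp [key]
      map_update_smul' := by
        intro _ m i a b
        ext t
        have key (c : C(X, E)) : (fun j => (Function.update m i c) j t) =
            Function.update (fun j => m j t) i (c t) := by
          ext j
          by_cases h : j = i
          · subst h; simp
          · simp [h]
        simp [key] }
    ‖p‖ (by
      intro m
      rw [ContinuousMap.norm_le _ (by positivity)]
      intro t
      refine (p.le_opNorm _).trans ?_
      gcongr with i
      exact (m i).norm_coe_le_norm t)

theorem norm_pointwiseMultilinear_le {n : ℕ} (p : E [×n]→L[ℝ] F) :
    ‖pointwiseMultilinear (X := X) p‖ ≤ ‖p‖ :=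
  MultilinearMap.mkContinuous_norm_le _ (norm_nonneg _) _

/-- Composition with an analytic map is an analytic operator on continuous functions, near a
constant function. -/
theorem exists_analyticAt_comp_const [CompleteSpace F] {g : E → F} {x₀ : E}
    (hg : AnalyticAt ℝ g x₀) :
    ∃ N : C(X, E) → C(X, F), AnalyticAt ℝ N (ContinuousMap.const X x₀) ∧
      ∃ r > 0, ∀ γ : C(X, E), (∀ t, dist (γ t) x₀ < r) → ∀ t, N γ t = g (γ t) := by
  obtain ⟨p, R, hp⟩ := hg
  -- Acting pointwise does not increase the norms of the Taylor terms, so the lifted series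
  -- converges at least where the original one does.
  let q : FormalMultilinearSeries ℝ C(X, E) C(X, F) := fun n => pointwiseMultilinear (p n)
  have hR : R ≤ q.radius := by
    refine hp.r_le.trans ?_
    exact FormalMultilinearSeries.radius_le_of_le fun n => norm_pointwiseMultilinear_le (p n)
  have hq : HasFPowerSeriesOnBall q.sum q 0 q.radius :=
    q.hasFPowerSeriesOnBall (hp.r_pos.trans_le hR)
  obtain ⟨r, hr0, hrR⟩ := ENNReal.lt_iff_exists_nnreal_btwn.1 hp.r_pos
  refine ⟨fun γ => q.sum (γ - ContinuousMap.const X x₀), ?_, r, by exact_mod_cast hr0, ?_⟩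
  · have h1 : AnalyticAt ℝ q.sum (ContinuousMap.const X x₀ - ContinuousMap.const X x₀) := by
      rw [sub_self]; exact hq.analyticAt
    exact h1.comp (f := fun γ => γ - ContinuousMap.const X x₀)
      (analyticAt_id.sub analyticAt_const)
  · intro γ hγ t
    set y : C(X, E) := γ - ContinuousMap.const X x₀ with hy
    have hyt (s : X) : y s = γ s - x₀ := rfl
    have hyn : ‖y‖ ≤ r := by
      rw [ContinuousMap.norm_le _ r.coe_nonneg]
      intro s
      rw [hyt, ← dist_eq_norm]
      exact (hγ s).le
    have hyR : y ∈ Metric.eball (0 : C(X, E)) q.radius := by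
      rw [Metric.mem_eball, edist_zero_right]
      refine lt_of_le_of_lt ?_ (hrR.trans_le hR)
      rw [enorm_le_coe]
      exact_mod_cast hyn
    have hs := hq.hasSum hyR
    rw [zero_add] at hs
    have hs' := hs.mapL (ContinuousMap.evalCLM ℝ t)
    have hyt' : y t ∈ Metric.eball (0 : E) R := by
      rw [Metric.mem_eball, edist_zero_right]
      refine lt_of_le_of_lt ?_ hrR
      rw [enorm_le_coe]
      exact_mod_cast (y.norm_coe_le_norm t).trans hyn
    have hs2 := hp.hasSum hyt'
    have := hs'.unique hs2
    rw [hyt, add_sub_cancel] at this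
    exact this

end Nemytskii

section Primitive

variable {E : Type*} [NormedAddCommGroup E] [NormedSpace ℝ E]

/-- The operator `γ ↦ ∫₀ˢ γ` on continuous functions on `[-1, 1]`. -/
noncomputable def primitiveCLM : C(Icc (-1 : ℝ) 1, E) →L[ℝ] C(Icc (-1 : ℝ) 1, E) :=
  LinearMap.mkContinuous
    { toFun := fun γ => ⟨fun s => ∫ u in (0 : ℝ)..s, γ (projIcc (-1) 1 (by norm_num) u), by
        have h : Continuous fun s : ℝ => ∫ u in (0 : ℝ)..s, γ (projIcc (-1) 1 (by norm_num) u) :=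
          intervalIntegral.continuous_primitive
            (fun a b => (γ.continuous.comp continuous_projIcc).intervalIntegrable a b) 0
        exact h.comp continuous_subtype_val⟩
      map_add' := by
        intro a b
        ext s
        exact intervalIntegral.integral_add
          ((a.continuous.comp continuous_projIcc).intervalIntegrable _ _)
          ((b.continuous.comp continuous_projIcc).intervalIntegrable _ _)
      map_smul' := by
        intro c a
        ext s
        exact intervalIntegral.integral_smul c _ }
    1 (by
      intro γ
      rw [ContinuousMap.norm_le _ (by positivity), one_mul]
      intro s
      refine (intervalIntegral.norm_integral_le_of_norm_le_const
        fun u _ => γ.norm_coe_le_norm _).trans ?_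
      rw [sub_zero]
      exact mul_le_of_le_one_right (norm_nonneg _) (abs_le.2 s.2))

theorem primitiveCLM_apply (γ : C(Icc (-1 : ℝ) 1, E)) (s : Icc (-1 : ℝ) 1) :
    primitiveCLM γ s = ∫ u in (0 : ℝ)..s, γ (projIcc (-1) 1 (by norm_num) u) := rfl

end Primitive

/-! ### The analytic local flow. -/

section Flow

variable {E : Type*} [NormedAddCommGroup E] [NormedSpace ℝ E] [CompleteSpace E]

/-- An autonomous analytic differential equation has an analytic local flow. -/
theorem exists_analyticAt_flow {g : E → E} {x₀ : E} (hg : AnalyticAt ℝ g x₀) :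
    ∃ Φ : ℝ × E → E, AnalyticAt ℝ Φ (0, x₀) ∧ (∀ᶠ z in 𝓝 x₀, Φ (0, z) = z) ∧
      ∀ᶠ p in 𝓝 ((0 : ℝ), x₀), HasDerivAt (fun t => Φ (t, p.2)) (g (Φ p)) p.1 := by
  obtain ⟨N, hN, r, hr, hNg⟩ := exists_analyticAt_comp_const (X := Icc (-1 : ℝ) 1) hg
  set κ : E →L[ℝ] C(Icc (-1 : ℝ) 1, E) := ContinuousLinearMap.const ℝ (Icc (-1 : ℝ) 1) with hκ
  set c₀ : C(Icc (-1 : ℝ) 1, E) := ContinuousMap.const (Icc (-1 : ℝ) 1) x₀ with hc₀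
  -- Zeros of `G` are time-rescaled solutions `s ↦ Φ (t * s, z)` of the integral equation. Rescaling
  -- turns the time `t` into a parameter and keeps all curves on the fixed interval `[-1, 1]`.
  set G : (ℝ × E) × C(Icc (-1 : ℝ) 1, E) → C(Icc (-1 : ℝ) 1, E) :=
    fun v => v.2 - κ v.1.2 - v.1.1 • primitiveCLM (N v.2) with hG
  set u₀ : (ℝ × E) × C(Icc (-1 : ℝ) 1, E) := ((0, x₀), c₀) with hu₀
  have hGa : AnalyticAt ℝ G u₀ := by
    have h1 : AnalyticAt ℝ (fun v : (ℝ × E) × C(Icc (-1 : ℝ) 1, E) => N v.2) u₀ :=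
      AnalyticAt.comp (g := N) (f := fun v : (ℝ × E) × C(Icc (-1 : ℝ) 1, E) => v.2) hN analyticAt_snd
    have hJ : AnalyticAt ℝ (fun γ => primitiveCLM (E := E) γ) (N u₀.2) :=
      (primitiveCLM (E := E)).analyticAt (N u₀.2)
    have h2 : AnalyticAt ℝ (fun v : (ℝ × E) × C(Icc (-1 : ℝ) 1, E) => primitiveCLM (N v.2)) u₀ :=
      hJ.comp (f := fun v : (ℝ × E) × C(Icc (-1 : ℝ) 1, E) => N v.2) h1
    have h3 : AnalyticAt ℝ (fun v : (ℝ × E) × C(Icc (-1 : ℝ) 1, E) => κ v.1.2) u₀ :=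
      (κ.analyticAt _).comp (analyticAt_snd.comp analyticAt_fst)
    have h4 : AnalyticAt ℝ (fun v : (ℝ × E) × C(Icc (-1 : ℝ) 1, E) => v.1.1) u₀ :=
      analyticAt_fst.comp analyticAt_fst
    exact (analyticAt_snd.sub h3).sub (h4.smul h2)
  have hGc : ContDiffAt ℝ ω G u₀ := hGa.contDiffAt
  have hG0 : G u₀ = 0 := by
    ext t
    simp [hG, hu₀, hκ, hc₀]
  -- At `t = 0` the integral term disappears, so the partial derivative in the curve is the
  -- identity.
  have hinr : fderiv ℝ G u₀ ∘L .inr ℝ (ℝ × E) C(Icc (-1 : ℝ) 1, E) = ContinuousLinearMap.id ℝ _ := by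
    have h1 : HasFDerivAt (fun γ => G ((0, x₀), γ)) (fderiv ℝ G u₀ ∘L .inr ℝ (ℝ × E) C(Icc (-1 : ℝ) 1, E)) c₀ :=
      HasFDerivAt.comp (g := G) c₀ hGa.differentiableAt.hasFDerivAt (hasFDerivAt_prodMk_right _ _)
    have h2 : HasFDerivAt (fun γ => G ((0, x₀), γ)) (ContinuousLinearMap.id ℝ C(Icc (-1 : ℝ) 1, E)) c₀ := by
      simp only [hG, zero_smul, sub_zero]
      exact (hasFDerivAt_id c₀).sub_const _
    exact h1.unique h2
  have hinv : (fderiv ℝ G u₀ ∘L .inr ℝ (ℝ × E) C(Icc (-1 : ℝ) 1, E)).IsInvertible := by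
    rw [hinr]; exact ⟨ContinuousLinearEquiv.refl ℝ _, rfl⟩
  have hω : (ω : WithTop ℕ∞) ≠ 0 := by simp
  set ψ := hGc.implicitFunction hω hinv with hψ
  have hψa : AnalyticAt ℝ ψ (0, x₀) := (hGc.contDiffAt_implicitFunction hω hinv).analyticAt
  have hψ0 : ψ (0, x₀) = c₀ := hGc.implicitFunction_apply_self hω hinv
  have hψG : ∀ᶠ x in 𝓝 ((0 : ℝ), x₀), G (x, ψ x) = 0 := by
    simpa [hG0] using hGc.eventually_apply_implicitFunction hω hinv
  have hψu : ∀ᶠ v in 𝓝 u₀, G v = 0 → ψ v.1 = v.2 := by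
    filter_upwards [hGc.eventually_apply_eq_iff_implicitFunction hω hinv] with v hv h
    exact hv.1 (h.trans hG0.symm)
  have hψc : ∀ ρ > 0, ∀ᶠ x in 𝓝 ((0 : ℝ), x₀), dist (ψ x) c₀ < ρ := by
    intro ρ hρ
    have := hψa.continuousAt.eventually (Metric.ball_mem_nhds _ hρ)
    simpa [hψ0] using this
  -- the integral equation satisfied by the curves
  have hint : ∀ᶠ x in 𝓝 ((0 : ℝ), x₀), ∀ s : Icc (-1 : ℝ) 1, ψ x s =
      x.2 + x.1 • ∫ u in (0 : ℝ)..s, g (ψ x (projIcc (-1) 1 (by norm_num) u)) := by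
    filter_upwards [hψG, hψc r hr] with x hx hxr s
    have h1 := congrArg (fun γ : C(Icc (-1 : ℝ) 1, E) => γ s) hx
    simp only [hG, ContinuousMap.sub_apply, ContinuousMap.smul_apply, primitiveCLM_apply,
      ContinuousMap.zero_apply] at h1
    have h2 : ∀ t, N (ψ x) t = g (ψ x t) := hNg _ fun t =>
      (ContinuousMap.dist_apply_le_dist (f := ψ x) (g := c₀) t).trans_lt hxr
    simp only [h2] at h1
    have h3 : κ x.2 s = x.2 := rfl
    rw [h3] at h1
    rw [sub_sub, sub_eq_zero] at h1
    exact h1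
  let mulI : Icc (-1 : ℝ) 1 → Icc (-1 : ℝ) 1 → Icc (-1 : ℝ) 1 := fun s u => ⟨(s : ℝ) * u, by
    have := abs_le.2 s.2; have := abs_le.2 u.2
    refine abs_le.1 ?_
    rw [abs_mul]
    exact mul_le_one₀ ‹_› (abs_nonneg _) ‹_›⟩
  -- The curve `u ↦ ψ x (s * u)` solves the equation with time `x.1 * s`; local uniqueness in the
  -- implicit function theorem identifies it with `ψ (x.1 * s, x.2)`.
  have hscale : ∀ᶠ x in 𝓝 ((0 : ℝ), x₀), ∀ s u : Icc (-1 : ℝ) 1, ψ (x.1 * s, x.2) u = ψ x (mulI s u) := by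
    obtain ⟨ρ, hρ, hρu⟩ := Metric.eventually_nhds_iff.1 hψu
    filter_upwards [hint, hψc (min r ρ) (lt_min hr hρ),
      Metric.ball_mem_nhds ((0 : ℝ), x₀) hρ] with x hx hxr hxρ s
    let γ : C(Icc (-1 : ℝ) 1, E) := ⟨fun u => ψ x (mulI s u), (ψ x).continuous.comp (by
      simp only [mulI]; fun_prop)⟩
    have hγ (u : Icc (-1 : ℝ) 1) : dist (γ u) x₀ < min r ρ :=
      (ContinuousMap.dist_apply_le_dist (f := ψ x) (g := c₀) (mulI s u)).trans_lt hxr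
    have hNγ := hNg γ fun u => (hγ u).trans_le (min_le_left _ _)
    have h1 : G ((x.1 * s, x.2), γ) = 0 := by
      ext u
      simp only [hG, ContinuousMap.sub_apply, ContinuousMap.smul_apply, primitiveCLM_apply,
        ContinuousMap.zero_apply, hNγ]
      have h3 : κ x.2 u = x.2 := rfl
      have h4 : γ u = ψ x (mulI s u) := rfl
      rw [h3, h4, hx, sub_sub, sub_eq_zero, mul_smul]
      congr 2
      have h5 := intervalIntegral.smul_integral_comp_mul_left (a := 0) (b := (u : ℝ))
        (fun w => g (ψ x (projIcc (-1) 1 (by norm_num) w))) (s : ℝ)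
      rw [mul_zero] at h5
      change ∫ w in (0 : ℝ)..(s * u : ℝ), _ = _
      rw [← h5]
      congr 1
      refine intervalIntegral.integral_congr fun w hw => ?_
      have hw' : w ∈ Icc (-1 : ℝ) 1 := by
        have h6 : uIcc (0 : ℝ) u ⊆ Icc (-1 : ℝ) 1 :=
          ordConnected_Icc.uIcc_subset (by norm_num) u.2
        exact h6 hw
      have h7 : (projIcc (-1 : ℝ) 1 (by norm_num) w : Icc (-1 : ℝ) 1) = ⟨w, hw'⟩ :=
        projIcc_of_mem _ hw'
      have h8 : (projIcc (-1 : ℝ) 1 (by norm_num) ((s : ℝ) * w) : Icc (-1 : ℝ) 1) =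
        mulI s ⟨w, hw'⟩ := projIcc_of_mem _ (mulI s ⟨w, hw'⟩).2
      change g (ψ x _) = g (ψ x (mulI s _))
      rw [h7, h8]
    have h2 : dist (((x.1 * s, x.2), γ) : (ℝ × E) × C(Icc (-1 : ℝ) 1, E)) u₀ < ρ := by
      rw [Prod.dist_eq, Prod.dist_eq]
      rw [Metric.mem_ball, Prod.dist_eq] at hxρ
      simp only [max_lt_iff] at hxρ ⊢
      refine ⟨⟨?_, hxρ.2⟩, ?_⟩
      · simp only [hu₀, dist_zero_right, norm_mul] at hxρ ⊢
        exact (mul_le_of_le_one_right (norm_nonneg _) (abs_le.2 s.2)).trans_lt hxρ.1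
      · exact (ContinuousMap.dist_lt_iff hρ).2 fun u => (hγ u).trans_le (min_le_right _ _)
    intro u
    exact congrArg (fun γ : C(Icc (-1 : ℝ) 1, E) => γ u) (hρu h2 h1)
  let one : Icc (-1 : ℝ) 1 := ⟨1, by norm_num, le_rfl⟩
  have hone (s : Icc (-1 : ℝ) 1) : mulI s one = s := Subtype.ext (mul_one _)
  refine ⟨fun x => ψ x one, ?_, ?_, ?_⟩
  · exact ((ContinuousMap.evalCLM ℝ one).analyticAt _).comp hψa
  · have h1 : Tendsto (fun z : E => ((0 : ℝ), z)) (𝓝 x₀) (𝓝 (0, x₀)) := by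
      exact (continuous_const.prodMk continuous_id).tendsto x₀
    filter_upwards [h1.eventually hint] with z hz
    simpa using hz one
  · obtain ⟨ρ, hρ, hρs⟩ := Metric.eventually_nhds_iff.1 (hscale.and (hint.and (hψc r hr)))
    filter_upwards [Metric.ball_mem_nhds ((0 : ℝ), x₀) (half_pos hρ)] with p hp
    rw [Metric.mem_ball, Prod.dist_eq, max_lt_iff] at hp
    simp only [dist_zero_right, Real.norm_eq_abs] at hp
    -- With `ε` fixed, `Φ (t, z) = ψ (ε, z) (t / ε)` for `|t| < ε`, so differentiating in `t`
    -- amounts to differentiating a primitive.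
    set ε := ρ / 2 with hε
    have hε0 : 0 < ε := half_pos hρ
    have hx : dist (ε, p.2) ((0 : ℝ), x₀) < ρ := by
      rw [Prod.dist_eq, max_lt_iff]
      simp only [dist_zero_right, Real.norm_eq_abs, abs_of_pos hε0]
      constructor <;> linarith
    obtain ⟨hxs, hxi, hxr⟩ := hρs hx
    have hNψ := hNg (ψ (ε, p.2)) fun t =>
      (ContinuousMap.dist_apply_le_dist (f := ψ (ε, p.2)) (g := c₀) t).trans_lt hxr
    simp only [← hNψ] at hxi
    have hΦ (t : ℝ) (ht : |t| < ε) : ∃ h : t / ε ∈ Icc (-1 : ℝ) 1, ψ (t, p.2) one = ψ (ε, p.2) ⟨t / ε, h⟩ := by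
      have h : t / ε ∈ Icc (-1 : ℝ) 1 := by
        refine abs_le.1 ?_
        rw [abs_div, abs_of_pos hε0, div_le_one hε0]
        exact ht.le
      refine ⟨h, ?_⟩
      have := hxs ⟨t / ε, h⟩ one
      rw [hone] at this
      rw [← this, mul_div_cancel₀ _ hε0.ne']
    have hcont : Continuous fun u : ℝ =>
        N (ψ (ε, p.2)) (projIcc (-1 : ℝ) 1 (by norm_num) u) :=
      (N (ψ (ε, p.2))).continuous.comp continuous_projIcc
    have h1 := (hcont.integral_hasStrictDerivAt 0 (p.1 / ε)).hasDerivAt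
    have h2 : HasDerivAt (fun t : ℝ => t / ε) (1 / ε) p.1 := (hasDerivAt_id _).div_const _
    have h3 := ((h1.scomp p.1 h2).const_smul ε).const_add p.2
    have h4 : (fun t => ψ (t, p.2) one) =ᶠ[𝓝 p.1] fun t => p.2 + ε •
        ∫ u in (0 : ℝ)..t / ε, N (ψ (ε, p.2)) (projIcc (-1 : ℝ) 1 (by norm_num) u) := by
      filter_upwards [continuous_abs.continuousAt.eventually (gt_mem_nhds hp.1)] with t ht
      obtain ⟨h, ht'⟩ := hΦ t ht
      rw [ht', hxi]
    refine (h3.congr_of_eventuallyEq h4).congr_deriv ?_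
    obtain ⟨h, ht'⟩ := hΦ p.1 hp.1
    have h5 : (projIcc (-1 : ℝ) 1 (by norm_num) (p.1 / ε) : Icc (-1 : ℝ) 1) = ⟨p.1 / ε, h⟩ :=
      projIcc_of_mem _ h
    rw [smul_smul, mul_one_div_cancel hε0.ne', one_smul, h5, hNψ, ← ht']

end Flow

/-! ### Orders of vanishing, roots and involutions in one variable. -/

section OneVariable

theorem tendsto_of_eventuallyEq_punctured {u v : ℝ → ℝ} (hu : ContinuousAt u 0)
    (hv : ContinuousAt v 0) (h : ∀ᶠ t in 𝓝[≠] (0 : ℝ), u t = v t) : u 0 = v 0 :=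
  tendsto_nhds_unique_of_eventuallyEq (hu.mono_left nhdsWithin_le_nhds)
    (hv.mono_left nhdsWithin_le_nhds) h

/-- Integration raises the order of vanishing by one and keeps the sign: the leading coefficients
satisfy `(n + 1) * w 0 = v 0`. -/
theorem exists_eq_pow_mul_of_deriv {f v : ℝ → ℝ} (hf : AnalyticAt ℝ f 0) (hf0 : f 0 = 0) {n : ℕ}
    (hv : AnalyticAt ℝ v 0) (hv0 : v 0 < 0) (h : ∀ᶠ t in 𝓝 0, deriv f t = t ^ n * v t) :
    ∃ w : ℝ → ℝ, AnalyticAt ℝ w 0 ∧ w 0 < 0 ∧ ∀ᶠ t in 𝓝 0, f t = t ^ (n + 1) * w t := by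
  have h1 : analyticOrderAt (deriv f) 0 = n :=
    hf.deriv.analyticOrderAt_eq_natCast.2 ⟨v, hv, hv0.ne, by simpa using h⟩
  have h2 : analyticOrderAt f 0 = (n + 1 : ℕ) := by
    rw [Nat.cast_add_one]
    exact (analyticOrderAt_deriv_eq_iff hf hf0).2 h1
  obtain ⟨w, hw, hw0, hfw⟩ := hf.analyticOrderAt_eq_natCast.1 h2
  simp only [sub_zero, smul_eq_mul] at hfw
  refine ⟨w, hw, ?_, hfw⟩
  have h3 : (n + 1) * w 0 = v 0 := by
    have := tendsto_of_eventuallyEq_punctured (u := fun t => (n + 1) * w t + t * deriv w t) (v := v)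
      ((hw.continuousAt.const_mul _).add (continuousAt_id.mul hw.deriv.continuousAt))
      hv.continuousAt ?_
    · simpa using this
    · have hd : ∀ᶠ t in 𝓝 (0 : ℝ), DifferentiableAt ℝ w t :=
        hw.eventually_analyticAt.mono fun t ht => ht.differentiableAt
      filter_upwards [nhdsWithin_le_nhds hfw.eventually_nhds, nhdsWithin_le_nhds h,
        nhdsWithin_le_nhds hd, self_mem_nhdsWithin] with t ht h't hdt ht0
      have h4 : deriv f t = _ := EventuallyEq.deriv_eq ht
      have h5 : HasDerivAt (fun t => t ^ (n + 1) * w t)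
          (((n + 1 : ℕ) : ℝ) * t ^ n * w t + t ^ (n + 1) * deriv w t) t :=
        (hasDerivAt_pow (n + 1) t).mul hdt.hasDerivAt
      rw [h5.deriv, h't] at h4
      have ht0' : t ^ n ≠ 0 := pow_ne_zero _ ht0
      apply mul_left_cancel₀ ht0'
      rw [h4]
      push_cast
      ring
  have hn : (0 : ℝ) < n + 1 := by positivity
  by_contra! hc
  nlinarith

/-- A factor `w` positive at `0` has the analytic root `exp (log w / n)`, which is absorbed into the
base of the power. -/
theorem exists_pow_eq {f w : ℝ → ℝ} {n : ℕ} (hn : n ≠ 0) (hw : AnalyticAt ℝ w 0) (hw0 : 0 < w 0)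
    (h : ∀ᶠ t in 𝓝 0, f t = t ^ n * w t) :
    ∃ σ : ℝ → ℝ, AnalyticAt ℝ σ 0 ∧ σ 0 = 0 ∧ 0 < deriv σ 0 ∧ ∀ᶠ t in 𝓝 0, f t = σ t ^ n := by
  have hl : AnalyticAt ℝ (fun t => Real.exp (Real.log (w t) / n)) 0 :=
    ((hw.log hw0).div analyticAt_const (Nat.cast_ne_zero.2 hn)).rexp
  refine ⟨fun t => t * Real.exp (Real.log (w t) / n), analyticAt_id.mul hl, by simp, ?_, ?_⟩
  · have : HasDerivAt (fun t => t * Real.exp (Real.log (w t) / n)) _ 0 :=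
      (hasDerivAt_id (0 : ℝ)).mul hl.differentiableAt.hasDerivAt
    rw [this.deriv]
    simpa using Real.exp_pos _
  · filter_upwards [h, hw.continuousAt.eventually (lt_mem_nhds hw0)] with t ht hwt
    rw [ht, mul_pow, ← Real.exp_nat_mul, mul_div_cancel₀ _ (Nat.cast_ne_zero.2 hn),
      Real.exp_log hwt]

theorem exists_analyticAt_inverse {f : ℝ → ℝ} (hf : AnalyticAt ℝ f 0) (hf0 : f 0 = 0)
    (hf' : deriv f 0 ≠ 0) :
    ∃ r : ℝ → ℝ, AnalyticAt ℝ r 0 ∧ r 0 = 0 ∧ deriv r 0 = (deriv f 0)⁻¹ ∧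
      (∀ᶠ t in 𝓝 0, r (f t) = t) ∧ ∀ᶠ x in 𝓝 0, f (r x) = x := by
  have h1 := hf.analyticAt_localInverse hf'
  have h2 := (hf.hasStrictDerivAt.to_localInverse hf').hasDerivAt.deriv
  have h3 := hf.hasStrictDerivAt.eventually_left_inverse hf'
  have h4 := hf.hasStrictDerivAt.eventually_right_inverse hf'
  have h5 := h3.self_of_nhds
  rw [hf0] at h1 h2 h4 h5
  exact ⟨_, h1, h5, h2, h3, h4⟩

/-- A function with nonzero derivative at `0` whose even power is prescribed has a local analytic
involution. -/
theorem exists_analyticAt_involution {σ : ℝ → ℝ} (hσ : AnalyticAt ℝ σ 0) (hσ0 : σ 0 = 0)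
    (hσ' : deriv σ 0 ≠ 0) :
    ∃ j : ℝ → ℝ, AnalyticAt ℝ j 0 ∧ j 0 = 0 ∧ deriv j 0 = -1 ∧ ∀ᶠ t in 𝓝 0, σ (j t) = -σ t := by
  obtain ⟨r, hr, hr0, hr', -, hσr⟩ := exists_analyticAt_inverse hσ hσ0 hσ'
  have hn : AnalyticAt ℝ (fun t => -σ t) 0 := hσ.neg
  have hr2 : AnalyticAt ℝ r (-σ 0) := by simpa [hσ0] using hr
  -- In the coordinate `σ` the involution is the reflection `s ↦ -s`.
  refine ⟨fun t => r (-σ t), hr2.comp (f := fun t => -σ t) hn, by simp [hσ0, hr0], ?_, ?_⟩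
  · have h1 : HasDerivAt (fun t => -σ t) (-deriv σ 0) 0 := hσ.differentiableAt.hasDerivAt.neg
    have h2 : HasDerivAt r (deriv σ 0)⁻¹ (-σ 0) := by
      rw [hσ0, neg_zero, ← hr']; exact hr.differentiableAt.hasDerivAt
    have h3 := (h2.comp (0 : ℝ) h1).deriv
    rw [mul_neg, inv_mul_cancel₀ hσ'] at h3
    exact h3
  · have h1 : Tendsto (fun t => -σ t) (𝓝 0) (𝓝 0) := by simpa [hσ0] using hn.continuousAt.tendsto
    exact h1.eventually hσr

/-- An analytic function `C` comparable to `-tⁿ v` has the form `tⁿ w`. -/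
theorem exists_eq_pow_mul_of_comparable {y C v : ℝ → ℝ} {n : ℕ} (hC : AnalyticAt ℝ C 0)
    (hv : AnalyticAt ℝ v 0) (hv0 : v 0 < 0) (hy : ∀ᶠ t in 𝓝 0, y t = t ^ n * v t)
    (h : ∀ᶠ t in 𝓝 0, |y t + C t| ≤ 1 / 2 * |C t|) :
    ∃ w : ℝ → ℝ, AnalyticAt ℝ w 0 ∧ 0 < w 0 ∧ ∀ᶠ t in 𝓝 0, C t = t ^ n * w t := by
  have hvn : ∀ᶠ t in 𝓝 (0 : ℝ), v t < 0 := hv.continuousAt.eventually (gt_mem_nhds hv0)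
  have hord : analyticOrderAt C 0 ≠ ⊤ := by
    intro htop
    rw [analyticOrderAt_eq_top] at htop
    have : ∀ᶠ t in 𝓝[≠] (0 : ℝ), False := by
      filter_upwards [nhdsWithin_le_nhds hy, nhdsWithin_le_nhds h, nhdsWithin_le_nhds htop,
        nhdsWithin_le_nhds hvn, self_mem_nhdsWithin] with t h1 h2 h3 h4 h5
      rw [h3, h1] at h2
      simp only [add_zero, abs_zero, mul_zero, abs_nonpos_iff, mul_eq_zero] at h2
      exact h2.elim (pow_ne_zero _ h5) h4.ne
    exact this.exists.elim fun _ => id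
  obtain ⟨w, hw, hw0, hCw⟩ := (hC.analyticOrderAt_ne_top).1 hord
  set m := analyticOrderNatAt C 0
  simp only [sub_zero, smul_eq_mul] at hCw
  have hlim {a b : ℝ → ℝ} (ha : ContinuousAt a 0) (hb : ContinuousAt b 0)
      (hab : ∀ᶠ t in 𝓝[≠] (0 : ℝ), a t ≤ b t) : a 0 ≤ b 0 :=
    le_of_tendsto_of_tendsto (ha.mono_left nhdsWithin_le_nhds) (hb.mono_left nhdsWithin_le_nhds) hab
  -- Divide the comparison by the smaller power of `t` and let `t → 0`: `m < n` would give `|w 0| ≤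
  -- |w 0| / 2`, and `m > n` would give `v 0 = 0`.
  have hmn : m = n := by
    rcases lt_trichotomy m n with hlt | heq | hgt
    · exfalso
      obtain ⟨d, rfl⟩ := Nat.exists_eq_add_of_lt hlt
      have := hlim (a := fun t => |t ^ (d + 1) * v t + w t|) (b := fun t => 1 / 2 * |w t|)
        (by have := hv.continuousAt; have := hw.continuousAt; fun_prop)
        (by have := hw.continuousAt; fun_prop) ?_
      · simp at this
        have := abs_pos.2 hw0
        linarith
      · filter_upwards [nhdsWithin_le_nhds hy, nhdsWithin_le_nhds h, nhdsWithin_le_nhds hCw,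
          self_mem_nhdsWithin] with t h1 h2 h3 h5
        have h6 : 0 < |t ^ m| := abs_pos.2 (pow_ne_zero _ h5)
        refine le_of_mul_le_mul_left ?_ h6
        calc |t ^ m| * |t ^ (d + 1) * v t + w t| = |y t + C t| := by
              rw [← abs_mul, h1, h3]; congr 1; ring
          _ ≤ 1 / 2 * |C t| := h2
          _ = _ := by rw [h3, abs_mul]; ring
    · exact heq
    · exfalso
      obtain ⟨d, hd⟩ := Nat.exists_eq_add_of_lt hgt
      have := hlim (a := fun t => |v t + t ^ (d + 1) * w t|)
        (b := fun t => 1 / 2 * |t ^ (d + 1) * w t|)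
        (by have := hv.continuousAt; have := hw.continuousAt; fun_prop)
        (by have := hw.continuousAt; fun_prop) ?_
      · simp at this
        exact hv0.ne this
      · filter_upwards [nhdsWithin_le_nhds hy, nhdsWithin_le_nhds h, nhdsWithin_le_nhds hCw,
          self_mem_nhdsWithin] with t h1 h2 h3 h5
        have h6 : 0 < |t ^ n| := abs_pos.2 (pow_ne_zero _ h5)
        have h7 : C t = t ^ n * (t ^ (d + 1) * w t) := by rw [h3, hd]; ring
        refine le_of_mul_le_mul_left ?_ h6
        calc |t ^ n| * |v t + t ^ (d + 1) * w t| = |y t + C t| := by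
              rw [← abs_mul, h1, h7]; congr 1; ring
          _ ≤ 1 / 2 * |C t| := h2
          _ = _ := by rw [h7, abs_mul]; ring
  rw [hmn] at hCw
  refine ⟨w, hw, ?_, hCw⟩
  -- With equal orders the limit is `|v 0 + w 0| ≤ |w 0| / 2`, impossible for `w 0 ≤ 0` because `v 0
  -- < 0`.
  have := hlim (a := fun t => |v t + w t|) (b := fun t => 1 / 2 * |w t|)
    (by have := hv.continuousAt; have := hw.continuousAt; fun_prop)
    (by have := hw.continuousAt; fun_prop) ?_
  · by_contra! hc
    rw [abs_of_nonpos hc, abs_of_nonpos (by linarith)] at this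
    linarith
  · filter_upwards [nhdsWithin_le_nhds hy, nhdsWithin_le_nhds h, nhdsWithin_le_nhds hCw,
      self_mem_nhdsWithin] with t h1 h2 h3 h5
    have h6 : 0 < |t ^ n| := abs_pos.2 (pow_ne_zero _ h5)
    refine le_of_mul_le_mul_left ?_ h6
    calc |t ^ n| * |v t + w t| = |y t + C t| := by
          rw [← abs_mul, h1, h3]; congr 1; ring
      _ ≤ 1 / 2 * |C t| := h2
      _ = _ := by rw [h3, abs_mul]; ring

/-- A function analytic at the origin and vanishing there is the sum of its power series. -/
theorem exists_power_series_of_analyticAt {f : ℝ → ℝ} (hf : AnalyticAt ℝ f 0) (hf0 : f 0 = 0) :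
    ∃ ρ > 0, ∃ a : ℕ → ℝ, ∀ x ∈ Ioo (-ρ) ρ,
      Summable (fun i : ℕ => a (i + 2) * x ^ (i + 2)) ∧
      f x = deriv f 0 * x + ∑' i : ℕ, a (i + 2) * x ^ (i + 2) := by
  obtain ⟨p, hp⟩ := hf
  have hp1 : p.coeff 1 = deriv f 0 := by
    rw [hp.deriv]; rfl
  have hp0 : p.coeff 0 = 0 := by
    rw [← hf0, ← hp.coeff_zero 1]; rfl
  have h := hasFPowerSeriesAt_iff.1 hp
  obtain ⟨ρ, hρ, h⟩ := Metric.eventually_nhds_iff.1 h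
  refine ⟨ρ, hρ, p.coeff, fun x hx => ?_⟩
  have hx' := h (y := x) (by rw [dist_zero_right]; exact abs_lt.2 hx)
  simp only [zero_add, smul_eq_mul] at hx'
  have h2 := (hasSum_nat_add_iff' 2).2 hx'
  simp only [Finset.sum_range_succ, Finset.sum_range_zero, hp0, hp1] at h2
  have hcomm (i : ℕ) : x ^ (i + 2) * p.coeff (i + 2) = p.coeff (i + 2) * x ^ (i + 2) := mul_comm _ _
  simp only [hcomm] at h2
  refine ⟨h2.summable, ?_⟩
  rw [h2.tsum_eq]
  ring

end OneVariable

/-! ### Uniqueness of solutions and of half-returns. -/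

section Uniqueness

variable {E : Type*} [NormedAddCommGroup E] [NormedSpace ℝ E]

/-- Uniqueness of solutions between the times `0` and `T`, of either sign. -/
theorem eqOn_uIcc_of_hasDerivWithinAt {v : E → E} {S : Set E} {K : ℝ≥0}
    (hv : LipschitzOnWith K v S) {f g : ℝ → E} {T : ℝ}
    (hf : ∀ t ∈ uIcc 0 T, HasDerivWithinAt f (v (f t)) (uIcc 0 T) t)
    (hfS : ∀ t ∈ uIcc 0 T, f t ∈ S)
    (hg : ∀ t ∈ uIcc 0 T, HasDerivWithinAt g (v (g t)) (uIcc 0 T) t)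
    (hgS : ∀ t ∈ uIcc 0 T, g t ∈ S) (h0 : f 0 = g 0) : EqOn f g (uIcc 0 T) := by
  have hfc : ContinuousOn f (uIcc 0 T) := fun t ht => (hf t ht).continuousWithinAt
  have hgc : ContinuousOn g (uIcc 0 T) := fun t ht => (hg t ht).continuousWithinAt
  rcases le_total 0 T with hT | hT
  · rw [uIcc_of_le hT] at *
    have key {h : ℝ → E} (hh : ∀ t ∈ Icc 0 T, HasDerivWithinAt h (v (h t)) (Icc 0 T) t) :
        ∀ t ∈ Ico 0 T, HasDerivWithinAt h (v (h t)) (Ici t) t := fun t ht =>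
      (hh t (Ico_subset_Icc_self ht)).mono_of_mem_nhdsWithin (Icc_mem_nhdsGE_of_mem ht)
    exact ODE_solution_unique_of_mem_Icc_right (v := fun _ => v) (s := fun _ => S) (K := K)
      (fun _ _ => hv) hfc (key hf) (fun t ht => hfS t (Ico_subset_Icc_self ht)) hgc (key hg)
      (fun t ht => hgS t (Ico_subset_Icc_self ht)) h0
  · rw [uIcc_of_ge hT] at *
    have key {h : ℝ → E} (hh : ∀ t ∈ Icc T 0, HasDerivWithinAt h (v (h t)) (Icc T 0) t) :
        ∀ t ∈ Ioc T 0, HasDerivWithinAt h (v (h t)) (Iic t) t := fun t ht =>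
      (hh t (Ioc_subset_Icc_self ht)).mono_of_mem_nhdsWithin (Icc_mem_nhdsLE_of_mem ht)
    exact ODE_solution_unique_of_mem_Icc_left (v := fun _ => v) (s := fun _ => S) (K := K)
      (fun _ _ => hv) hfc (key hf) (fun t ht => hfS t (Ioc_subset_Icc_self ht)) hgc (key hg)
      (fun t ht => hgS t (Ioc_subset_Icc_self ht)) h0

end Uniqueness

theorem convex_upperHalf : Convex ℝ upperHalf :=
  convex_halfSpace_ge (f := Prod.snd) ⟨fun _ _ => rfl, fun _ _ => rfl⟩ 0

theorem isClosed_upperHalf : IsClosed upperHalf :=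
  isClosed_le continuous_const continuous_snd

theorem uniqueDiffOn_upperHalf : UniqueDiffOn ℝ upperHalf := by
  refine uniqueDiffOn_convex convex_upperHalf ⟨(0, 1), ?_⟩
  have h : {p : ℝ × ℝ | 0 < p.2} ⊆ interior upperHalf :=
    interior_maximal (fun p (hp : 0 < p.2) => hp.le) (isOpen_lt continuous_const continuous_snd)
  exact h (show (0 : ℝ) < 1 from one_pos)

/-- Two solutions in the closed upper half-plane with the same initial value agree. -/
theorem eqOn_uIcc_of_mem_upperHalf {Z : ℝ × ℝ → ℝ × ℝ} (hZ : AnalyticOn ℝ Z upperHalf)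
    {f g : ℝ → ℝ × ℝ} {T : ℝ}
    (hf : ∀ t ∈ uIcc 0 T, HasDerivWithinAt f (Z (f t)) (uIcc 0 T) t)
    (hfS : ∀ t ∈ uIcc 0 T, f t ∈ upperHalf)
    (hg : ∀ t ∈ uIcc 0 T, HasDerivWithinAt g (Z (g t)) (uIcc 0 T) t)
    (hgS : ∀ t ∈ uIcc 0 T, g t ∈ upperHalf) (h0 : f 0 = g 0) : EqOn f g (uIcc 0 T) := by
  have hfc : ContinuousOn f (uIcc 0 T) := fun t ht => (hf t ht).continuousWithinAt
  have hgc : ContinuousOn g (uIcc 0 T) := fun t ht => (hg t ht).continuousWithinAt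
  -- Both arcs are compact, hence lie in a convex compact part of Σ⁺, where the smooth field has a
  -- single Lipschitz constant.
  obtain ⟨R, hR⟩ := ((isCompact_uIcc.image_of_continuousOn hfc).union
    (isCompact_uIcc.image_of_continuousOn hgc)).isBounded.subset_closedBall 0
  have hcomp : IsCompact (Metric.closedBall (0 : ℝ × ℝ) R ∩ upperHalf) :=
    (isCompact_closedBall _ _).inter_right isClosed_upperHalf
  have hC : ContDiffOn ℝ ω Z (Metric.closedBall (0 : ℝ × ℝ) R ∩ upperHalf) :=
    (hZ.contDiffOn uniqueDiffOn_upperHalf).mono inter_subset_right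
  obtain ⟨K, hK⟩ := hC.exists_lipschitzOnWith (by simp)
    ((convex_closedBall _ _).inter convex_upperHalf) hcomp
  exact eqOn_uIcc_of_hasDerivWithinAt hK hf
    (fun t ht => ⟨hR (Or.inl (mem_image_of_mem f ht)), hfS t ht⟩) hg
    (fun t ht => ⟨hR (Or.inr (mem_image_of_mem g ht)), hgS t ht⟩) h0

theorem IsHalfReturn.mem_upperHalf {γ : ℝ → ℝ × ℝ} {x τ ξ : ℝ} (h0 : γ 0 = (x, 0))
    (hτ : γ τ = (ξ, 0)) (h : ∀ t ∈ uIoo 0 τ, γ t ∈ upperHalf \ switchingLine) :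
    ∀ t ∈ uIcc 0 τ, γ t ∈ upperHalf := by
  intro t ht
  by_cases h1 : t = 0
  · rw [h1, h0]; exact le_refl (0 : ℝ)
  by_cases h2 : t = τ
  · rw [h2, hτ]; exact le_refl (0 : ℝ)
  refine (h t ?_).1
  rcases mem_uIcc.1 ht with h3 | h3
  · exact mem_uIoo_of_lt (lt_of_le_of_ne h3.1 (Ne.symm h1)) (lt_of_le_of_ne h3.2 h2)
  · exact mem_uIoo_of_gt (lt_of_le_of_ne h3.1 (Ne.symm h2)) (lt_of_le_of_ne h3.2 h1)

/-- An arc in the upper half-plane of a local extension of `Z`, which enters the lower half-plane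
at its initial end, is the only half-return of its initial point. -/
theorem isHalfReturn_iff {Z g : ℝ × ℝ → ℝ × ℝ} (hZ : AnalyticOn ℝ Z upperHalf) {B : Set (ℝ × ℝ)}
    (hB : IsOpen B) (hgZ : ∀ p ∈ B, p ∈ upperHalf → g p = Z p) {K : ℝ≥0}
    (hgK : LipschitzOnWith K g B) {η : ℝ → ℝ × ℝ} {x τ ξ : ℝ} (hτ : τ ≠ 0) (h0 : η 0 = (x, 0))
    (h1 : η τ = (ξ, 0)) (hηB : ∀ t ∈ uIcc 0 τ, η t ∈ B)
    (hη : ∀ t ∈ uIcc 0 τ, HasDerivAt η (g (η t)) t)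
    (hη0 : ∀ᶠ t in 𝓝 0, HasDerivAt η (g (η t)) t)
    (hpos : ∀ t ∈ uIoo 0 τ, 0 < (η t).2)
    (hneg : ∀ᶠ t in 𝓝 (0 : ℝ), t * τ < 0 → (η t).2 < 0) (t ξ' : ℝ) :
    IsHalfReturn Z x t ξ' ↔ t = τ ∧ ξ' = ξ := by
  have hηu : ∀ t ∈ uIoo 0 τ, η t ∈ upperHalf \ switchingLine := fun t ht =>
    ⟨(hpos t ht).le, (hpos t ht).ne'⟩
  have hηU := IsHalfReturn.mem_upperHalf h0 h1 hηu
  have hηZ : ∀ t ∈ uIcc 0 τ, HasDerivWithinAt η (Z (η t)) (uIcc 0 τ) t := fun t ht => by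
    rw [← hgZ _ (hηB t ht) (hηU t ht)]
    exact (hη t ht).hasDerivWithinAt
  constructor
  swap
  · rintro ⟨rfl, rfl⟩
    exact ⟨hτ, η, h0, h1, hηZ, hηu⟩
  rintro ⟨ht, γ, hγ0, hγt, hγ, hγu⟩
  have hγU := IsHalfReturn.mem_upperHalf hγ0 hγt hγu
  -- A half-return in the opposite time direction would follow `η` for a short while, hence enter
  -- the lower half-plane. There only `g` is controlled, so the comparison uses its Lipschitz bound
  -- on `B`.
  rcases lt_or_ge (t * τ) 0 with hsign | hsign
  · exfalso
    have hγc : ContinuousWithinAt γ (uIcc 0 t) 0 := (hγ 0 left_mem_uIcc).continuousWithinAt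
    have hxB : (x, (0 : ℝ)) ∈ B := h0 ▸ hηB 0 left_mem_uIcc
    have hγB : ∀ᶠ s in 𝓝 0, s ∈ uIcc 0 t → γ s ∈ B :=
      eventually_nhdsWithin_iff.1 (hγc.eventually (by rw [hγ0]; exact hB.mem_nhds hxB))
    have hηB' : ∀ᶠ s in 𝓝 0, η s ∈ B :=
      hη0.self_of_nhds.continuousAt.eventually (by rw [h0]; exact hB.mem_nhds hxB)
    obtain ⟨ρ, hρ, hall⟩ := Metric.eventually_nhds_iff.1 (hγB.and (hηB'.and (hη0.and hneg)))
    -- The factor `l` shrinks `t` to a time of the same sign and of size at most `ρ / 2`.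
    set l := min 1 (ρ / (2 * |t|)) with hl
    have htp : 0 < |t| := abs_pos.2 ht
    have hl0 : 0 < l := lt_min one_pos (by positivity)
    have hl1 : l ≤ 1 := min_le_left _ _
    set s := l * t with hs
    have hst : uIcc 0 s ⊆ uIcc 0 t := by
      refine uIcc_subset_uIcc_left ?_
      rcases le_total 0 t with h | h
      · rw [uIcc_of_le h]; constructor <;> nlinarith
      · rw [uIcc_of_ge h]; constructor <;> nlinarith
    have hsρ : ∀ u ∈ uIcc 0 s, dist u 0 < ρ := by
      intro u hu
      have h2 := abs_sub_left_of_mem_uIcc hu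
      rw [sub_zero, sub_zero] at h2
      rw [dist_zero_right, Real.norm_eq_abs]
      have h3 : |s| ≤ ρ / 2 := by
        rw [hs, abs_mul, abs_of_pos hl0]
        calc l * |t| ≤ ρ / (2 * |t|) * |t| := by gcongr; exact min_le_right _ _
          _ = ρ / 2 := by field_simp
      linarith
    have heq : EqOn γ η (uIcc 0 s) := by
      refine eqOn_uIcc_of_hasDerivWithinAt hgK (fun u hu => ?_)
        (fun u hu => (hall (hsρ u hu)).1 (hst hu))
        (fun u hu => (hall (hsρ u hu)).2.2.1.hasDerivWithinAt)
        (fun u hu => (hall (hsρ u hu)).2.1) (hγ0.trans h0.symm)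
      rw [hgZ _ ((hall (hsρ u hu)).1 (hst hu)) (hγU u (hst hu))]
      exact (hγ u (hst hu)).mono hst
    have h2 := (hall (hsρ s right_mem_uIcc)).2.2.2 (by rw [hs, mul_assoc]; nlinarith)
    rw [← heq right_mem_uIcc] at h2
    exact absurd (hγU s (hst right_mem_uIcc)) (not_le.2 h2)
  · have hagree : ∀ T, uIcc 0 T ⊆ uIcc 0 t → uIcc 0 T ⊆ uIcc 0 τ → EqOn γ η (uIcc 0 T) :=
      fun T hT hT' => eqOn_uIcc_of_mem_upperHalf hZ
        (fun u hu => (hγ u (hT hu)).mono hT) (fun u hu => hγU u (hT hu))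
        (fun u hu => (hηZ u (hT' hu)).mono hT') (fun u hu => hηU u (hT' hu)) (hγ0.trans h0.symm)
    -- If the two times differed, the arc landing first would be on Σ while the other, equal to it
    -- up to that time, is strictly above.
    have hcases : t = τ ∨ t ∈ uIoo 0 τ ∨ τ ∈ uIoo 0 t := by
      rcases lt_or_gt_of_ne ht with h2 | h2 <;> rcases lt_or_gt_of_ne hτ with h3 | h3
      · rcases lt_trichotomy t τ with h4 | h4 | h4
        · exact Or.inr (Or.inr (mem_uIoo_of_gt h4 h3))
        · exact Or.inl h4
        · exact Or.inr (Or.inl (mem_uIoo_of_gt h4 h2))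
      · nlinarith
      · nlinarith
      · rcases lt_trichotomy t τ with h4 | h4 | h4
        · exact Or.inr (Or.inl (mem_uIoo_of_lt h2 h4))
        · exact Or.inl h4
        · exact Or.inr (Or.inr (mem_uIoo_of_lt h3 h4))
    rcases hcases with h2 | h2 | h2
    · subst h2
      have h3 := hagree t Subset.rfl Subset.rfl right_mem_uIcc
      rw [hγt, h1] at h3
      exact ⟨rfl, congrArg Prod.fst h3⟩
    · exfalso
      have h3 := hagree t Subset.rfl (uIcc_subset_uIcc_left (uIoo_subset_uIcc_self h2))
        right_mem_uIcc
      have h4 := hpos t h2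
      rw [← h3, hγt] at h4
      exact lt_irrefl _ h4
    · exfalso
      have h3 := hagree τ (uIcc_subset_uIcc_left (uIoo_subset_uIcc_self h2)) Subset.rfl
        right_mem_uIcc
      have h4 := (hγu τ h2).2
      rw [h3, h1] at h4
      exact h4 rfl

/-! ### From Lie derivatives to the height along an orbit. -/

section LieDerivative

/-- The Lie derivative on an open set. -/
noncomputable def openLieDeriv (g : ℝ × ℝ → ℝ × ℝ) (f : ℝ × ℝ → ℝ) : ℝ × ℝ → ℝ :=
  fun p => fderiv ℝ f p (g p)

variable {Z g : ℝ × ℝ → ℝ × ℝ}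

theorem analyticAt_iterate_openLieDeriv {p : ℝ × ℝ} (hg : AnalyticAt ℝ g p) (i : ℕ) :
    AnalyticAt ℝ ((openLieDeriv g)^[i] Prod.snd) p := by
  induction i with
  | zero => exact analyticAt_snd
  | succ i ih =>
    rw [Function.iterate_succ_apply']
    exact (ContDiffAt.clm_apply (n := ω) ih.fderiv.contDiffAt hg.contDiffAt).analyticAt

/-- Transfers the contact hypothesis to the extension `g`. Agreement is needed near the point within
Σ⁺, since each further derivative sees neighbouring values. -/
theorem eventuallyEq_iterate_lieDeriv {p₀ : ℝ × ℝ} (hg : AnalyticAt ℝ g p₀)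
    (h : Z =ᶠ[𝓝[upperHalf] p₀] g) (i : ℕ) :
    (lieDeriv Z)^[i] Prod.snd =ᶠ[𝓝[upperHalf] p₀] (openLieDeriv g)^[i] Prod.snd := by
  induction i with
  | zero => exact EventuallyEq.rfl
  | succ i ih =>
    rw [Function.iterate_succ_apply', Function.iterate_succ_apply']
    filter_upwards [eventually_eventually_nhdsWithin.2 ih, h, self_mem_nhdsWithin,
      nhdsWithin_le_nhds (analyticAt_iterate_openLieDeriv hg i).eventually_analyticAt]
      with p hp hZp hpu han
    have h1 : (lieDeriv Z)^[i] Prod.snd p = (openLieDeriv g)^[i] Prod.snd p :=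
      EventuallyEq.eq_of_nhdsWithin hp hpu
    simp only [lieDeriv, openLieDeriv]
    rw [EventuallyEq.fderivWithin_eq hp h1, hZp,
      han.differentiableAt.fderivWithin (uniqueDiffOn_upperHalf p hpu)]

/-- If the first nonzero Lie derivative of the height along an orbit is negative, so is the leading
coefficient of the height. -/
theorem exists_height_eq_pow_mul {ζ : ℝ → ℝ × ℝ} (hg : AnalyticAt ℝ g (ζ 0))
    (hζ : AnalyticAt ℝ ζ 0) (hd : ∀ᶠ t in 𝓝 0, HasDerivAt ζ (g (ζ t)) t) {n : ℕ}
    (h0 : ∀ i < n, (openLieDeriv g)^[i] Prod.snd (ζ 0) = 0)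
    (hn : (openLieDeriv g)^[n] Prod.snd (ζ 0) < 0) :
    ∃ v : ℝ → ℝ, AnalyticAt ℝ v 0 ∧ v 0 < 0 ∧ ∀ᶠ t in 𝓝 0, (ζ t).2 = t ^ n * v t := by
  have hu (i : ℕ) : AnalyticAt ℝ (fun t => (openLieDeriv g)^[i] Prod.snd (ζ t)) 0 :=
    (analyticAt_iterate_openLieDeriv hg i).comp hζ
  have hu' (i : ℕ) : ∀ᶠ t in 𝓝 0, deriv (fun t => (openLieDeriv g)^[i] Prod.snd (ζ t)) t =
      (openLieDeriv g)^[i + 1] Prod.snd (ζ t) := by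
    filter_upwards [hd, hζ.continuousAt.eventually
      (analyticAt_iterate_openLieDeriv hg i).eventually_analyticAt] with t ht han
    rw [Function.iterate_succ_apply']
    exact (han.differentiableAt.hasFDerivAt.comp_hasDerivAt t ht).deriv
  -- Along the orbit each Lie derivative is the time derivative of the preceding one, so integrating
  -- `n` times from the negative one descends to the height.
  have key : ∀ d ≤ n, ∃ v : ℝ → ℝ, AnalyticAt ℝ v 0 ∧ v 0 < 0 ∧
      ∀ᶠ t in 𝓝 0, (openLieDeriv g)^[n - d] Prod.snd (ζ t) = t ^ d * v t := by
    intro d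
    induction d with
    | zero => exact fun _ => ⟨_, hu n, hn, by simp⟩
    | succ d ih =>
      intro hdn
      obtain ⟨v, hv, hv0, h⟩ := ih (by omega)
      refine exists_eq_pow_mul_of_deriv (hu (n - (d + 1))) (h0 _ (by omega)) hv hv0 ?_
      filter_upwards [hu' (n - (d + 1)), h] with t h1 h2
      rw [h1, ← h2, show n - (d + 1) + 1 = n - d by omega]
  simpa using key n le_rfl

end LieDerivative

/-! ### Orbits labelled by height, and their crossings with Σ. -/

/-- The zero curve `c = C t` of a function `F (t, c)` with `F (0, c) = c`, and the comparison of `F`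
with `c - C t`. -/
theorem exists_zero_curve {F : ℝ × ℝ → ℝ} (hF : AnalyticAt ℝ F (0, 0))
    (h0 : ∀ᶠ c in 𝓝 (0 : ℝ), F (0, c) = c) :
    ∃ C : ℝ → ℝ, AnalyticAt ℝ C 0 ∧ C 0 = 0 ∧ (∀ᶠ t in 𝓝 0, F (t, C t) = 0) ∧
      ∃ δ > 0, ∀ t c c' : ℝ, |t| < δ → |c| < δ → |c'| < δ →
        |F (t, c) - F (t, c') - (c - c')| ≤ 1 / 2 * |c - c'| := by
  have hc : ContDiffAt ℝ ω F (0, 0) := hF.contDiffAt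
  have hF0 : F (0, 0) = 0 := h0.self_of_nhds
  have hinr : fderiv ℝ F (0, 0) ∘L .inr ℝ ℝ ℝ = ContinuousLinearMap.id ℝ ℝ := by
    have h1 : HasFDerivAt (fun c => F (0, c)) (fderiv ℝ F (0, 0) ∘L .inr ℝ ℝ ℝ) 0 :=
      HasFDerivAt.comp (g := F) (0 : ℝ) hF.differentiableAt.hasFDerivAt
        (hasFDerivAt_prodMk_right _ _)
    exact h1.unique ((hasFDerivAt_id (0 : ℝ)).congr_of_eventuallyEq h0)
  have hinv : (fderiv ℝ F (0, 0) ∘L .inr ℝ ℝ ℝ).IsInvertible := by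
    rw [hinr]; exact ⟨ContinuousLinearEquiv.refl ℝ _, rfl⟩
  have hω : (ω : WithTop ℕ∞) ≠ 0 := by simp
  refine ⟨hc.implicitFunction hω hinv, (hc.contDiffAt_implicitFunction hω hinv).analyticAt,
    hc.implicitFunction_apply_self hω hinv, ?_, ?_⟩
  · simpa [hF0] using hc.eventually_apply_implicitFunction hω hinv
  · have h1 := hF.hasStrictFDerivAt.isLittleO.def (c := 1 / 2) (by norm_num)
    obtain ⟨δ, hδ, h1⟩ := Metric.eventually_nhds_iff.1 h1
    refine ⟨δ, hδ, fun t c c' ht hc hc' => ?_⟩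
    have h2 := h1 (y := ((t, c), (t, c'))) (by
      simp only [Prod.dist_eq, dist_zero_right, Real.norm_eq_abs, max_lt_iff]
      exact ⟨⟨ht, hc⟩, ht, hc'⟩)
    have h3 : fderiv ℝ F (0, 0) ((t, c) - (t, c')) = c - c' := by
      have := DFunLike.congr_fun hinr (c - c')
      simpa using this
    simp only [h3] at h2
    simpa [Prod.norm_def] using h2

theorem exists_strictMonoOn_of_deriv_pos {σ : ℝ → ℝ} (hσ : AnalyticAt ℝ σ 0)
    (hσ' : 0 < deriv σ 0) : ∃ δ > 0, StrictMonoOn σ (Ioo (-δ) δ) := by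
  obtain ⟨δ, hδ, h⟩ := Metric.eventually_nhds_iff.1 (hσ.eventually_analyticAt.and
    (hσ.deriv.continuousAt.eventually (lt_mem_nhds hσ')))
  have h' : ∀ t ∈ Ioo (-δ) δ, AnalyticAt ℝ σ t ∧ 0 < deriv σ t := fun t ht =>
    h (by rw [dist_zero_right]; exact abs_lt.2 ht)
  refine ⟨δ, hδ, strictMonoOn_of_deriv_pos (convex_Ioo _ _)
    (fun t ht => (h' t ht).1.continuousAt.continuousWithinAt) fun t ht => ?_⟩
  rw [interior_Ioo] at ht
  exact (h' t ht).2

/-- The half-return between two times of a flow at which the flow crosses the switching line. -/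
theorem isHalfReturn_iff_of_flow {Z g : ℝ × ℝ → ℝ × ℝ} (hZ : AnalyticOn ℝ Z upperHalf)
    {B : Set (ℝ × ℝ)} (hB : IsOpen B) (hgZ : ∀ p ∈ B, p ∈ upperHalf → g p = Z p) {K : ℝ≥0}
    (hgK : LipschitzOnWith K g B) {Ψ : ℝ × ℝ → ℝ × ℝ} {C σ : ℝ → ℝ} {k : ℕ} (hk : k ≠ 0) {δ ε : ℝ}
    (hΨ : ∀ t c : ℝ, |t| < δ → |c| < ε →
      HasDerivAt (fun s => Ψ (s, c)) (g (Ψ (t, c))) t ∧ Ψ (t, c) ∈ B)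
    (hcmp : ∀ t c c' : ℝ, |t| < δ → |c| < ε → |c'| < ε →
      |(Ψ (t, c)).2 - (Ψ (t, c')).2 - (c - c')| ≤ 1 / 2 * |c - c'|)
    (hC : ∀ t : ℝ, |t| < δ → |C t| < ε ∧ (Ψ (t, C t)).2 = 0 ∧ C t = σ t ^ (2 * k))
    (hσ : StrictMonoOn σ (Ioo (-δ) δ)) (hσ0 : σ 0 = 0) {t₀ t₁ : ℝ} (ht₀ : |t₀| < δ)
    (ht₁ : |t₁| < δ) (ht₀' : t₀ ≠ 0) (hσt : σ t₁ = -σ t₀) (t ξ : ℝ) :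
    IsHalfReturn Z (Ψ (t₀, C t₀)).1 t ξ ↔ t = t₁ - t₀ ∧ ξ = (Ψ (t₁, C t₁)).1 := by
  have hδ : 0 < δ := (abs_nonneg _).trans_lt ht₀
  have m₀ := abs_lt.1 ht₀
  have m₁ := abs_lt.1 ht₁
  have mz : (0 : ℝ) ∈ Ioo (-δ) δ := ⟨by linarith, hδ⟩
  have heven : Even (2 * k) := even_two_mul k
  have hk2 : 2 * k ≠ 0 := by omega
  -- The exponent is even, so opposite values of `σ` give the same label: both crossings are on one
  -- orbit.
  have hC₁ : C t₁ = C t₀ := by rw [(hC _ ht₁).2.2, (hC _ ht₀).2.2, hσt, heven.neg_pow]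
  have hσ0' : σ t₀ ≠ 0 := fun h => ht₀' (hσ.injOn m₀ mz (h.trans hσ0.symm))
  have hτ : t₁ - t₀ ≠ 0 := by
    intro h
    rw [sub_eq_zero] at h
    rw [h] at hσt
    exact hσ0' (by linarith)
  -- Comparing the labels `C t₀` and `C u` at time `u`, where the orbit `C u` has height `0`, gives
  -- the height the sign of `C t₀ - C u`.
  have hup (u : ℝ) (hu : |u| < δ) (h : |σ u| < |σ t₀|) : 0 < (Ψ (u, C t₀)).2 := by
    have h1 : C u < C t₀ := by
      rw [(hC _ hu).2.2, (hC _ ht₀).2.2, ← heven.pow_abs, ← heven.pow_abs (σ t₀)]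
      exact pow_lt_pow_left₀ h (abs_nonneg _) hk2
    have h2 := hcmp u (C t₀) (C u) hu (hC _ ht₀).1 (hC _ hu).1
    rw [(hC _ hu).2.1, abs_of_pos (sub_pos.2 h1)] at h2
    have := (abs_le.1 h2).1
    linarith
  have hdown (u : ℝ) (hu : |u| < δ) (h : |σ t₀| < |σ u|) : (Ψ (u, C t₀)).2 < 0 := by
    have h1 : C t₀ < C u := by
      rw [(hC _ hu).2.2, (hC _ ht₀).2.2, ← heven.pow_abs, ← heven.pow_abs (σ u)]
      exact pow_lt_pow_left₀ h (abs_nonneg _) hk2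
    have h2 := hcmp u (C t₀) (C u) hu (hC _ ht₀).1 (hC _ hu).1
    rw [(hC _ hu).2.1, abs_of_neg (sub_neg.2 h1)] at h2
    have := (abs_le.1 h2).2
    linarith
  have hshift (s : ℝ) (hs : |t₀ + s| < δ) :
      HasDerivAt (fun s => Ψ (t₀ + s, C t₀)) (g (Ψ (t₀ + s, C t₀))) s :=
    (hΨ _ _ hs (hC _ ht₀).1).1.comp_const_add t₀ s
  have hin (s : ℝ) (hs : s ∈ uIcc 0 (t₁ - t₀)) : |t₀ + s| < δ := by
    rcases mem_uIcc.1 hs with h | h <;> rw [abs_lt] <;> constructor <;> linarith [h.1, h.2]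
  have hnear : ∀ᶠ s in 𝓝 (0 : ℝ), |t₀ + s| < δ := by
    have : ContinuousAt (fun s : ℝ => |t₀ + s|) 0 := by fun_prop
    exact this.eventually (gt_mem_nhds (by simpa using ht₀))
  refine isHalfReturn_iff hZ hB hgZ hgK (η := fun s => Ψ (t₀ + s, C t₀)) hτ ?_ ?_ ?_ ?_ ?_ ?_ ?_ t ξ
  · simp only [add_zero]
    exact Prod.ext rfl (hC _ ht₀).2.1
  · simp only [add_sub_cancel]
    rw [← hC₁]
    exact Prod.ext rfl (hC _ ht₁).2.1
  · exact fun s hs => (hΨ _ _ (hin s hs) (hC _ ht₀).1).2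
  · exact fun s hs => hshift s (hin s hs)
  · exact hnear.mono hshift
  · intro s hs
    have hs' := hin s (uIoo_subset_uIcc_self hs)
    have ms := abs_lt.1 hs'
    refine hup _ hs' ?_
    rw [uIoo_eq_union] at hs
    rcases hs with h | h
    · have h1 := hσ m₀ ms (by linarith [h.1])
      have h2 := hσ ms m₁ (by linarith [h.2])
      rw [abs_of_neg (a := σ t₀) (by linarith), abs_lt]
      constructor <;> linarith
    · have h1 := hσ ms m₀ (by linarith [h.2])
      have h2 := hσ m₁ ms (by linarith [h.1])
      rw [abs_of_pos (a := σ t₀) (by linarith), abs_lt]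
      constructor <;> linarith
  · filter_upwards [hnear] with s hs hsτ
    have ms := abs_lt.1 hs
    refine hdown _ hs ?_
    rcases mul_neg_iff.1 hsτ with h | h
    · have h1 := hσ m₀ ms (by linarith [h.1])
      have h2 := hσ m₁ m₀ (by linarith [h.2])
      rw [abs_of_pos (a := σ t₀) (by linarith)]
      exact h1.trans_le (le_abs_self _)
    · have h1 := hσ ms m₀ (by linarith [h.1])
      have h2 := hσ m₀ m₁ (by linarith [h.2])
      rw [abs_of_neg (a := σ t₀) (by linarith)]
      exact (neg_lt_neg h1).trans_le (neg_le_abs _)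

/-- The first Lie derivative is `Q(0,0)`, which vanishes because `1 < 2 * k`. If `P(0,0)` vanished
too, every Lie derivative of positive order would be zero at the origin. -/
theorem fst_ne_zero_of_hasInvisibleEvenContact {Z : ℝ × ℝ → ℝ × ℝ} {k : ℕ}
    (hk : HasInvisibleEvenContact Z (0, 0) k) : (Z (0, 0)).1 ≠ 0 := by
  obtain ⟨hk1, ⟨h0, -⟩, hn⟩ := hk
  intro h
  have h1 : (lieDeriv Z)^[1] Prod.snd (0, 0) = (Z (0, 0)).2 := by
    have h2 : (fderivWithin ℝ Prod.snd upperHalf ((0 : ℝ), (0 : ℝ))) =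
        ContinuousLinearMap.snd ℝ ℝ ℝ :=
      hasFDerivAt_snd.hasFDerivWithinAt.fderivWithin
        (uniqueDiffOn_upperHalf _ (le_refl (0 : ℝ)))
    simp only [Function.iterate_one, lieDeriv, h2]
    rfl
  have h2 : Z (0, 0) = 0 := Prod.ext h (h1.symm.trans (h0 1 (by omega)))
  obtain ⟨m, hm⟩ : ∃ m, 2 * k = m + 1 := ⟨2 * k - 1, by omega⟩
  rw [hm, Function.iterate_succ_apply'] at hn
  simp only [lieDeriv, h2, map_zero] at hn
  exact lt_irrefl _ hn

/-! ### Construction of the half-return map and the flight time. -/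

/-- The half-return map and the flight time near an invisible contact of even multiplicity. -/
theorem exists_analyticAt_halfReturn {Z : ℝ × ℝ → ℝ × ℝ} (hZ : AnalyticOn ℝ Z upperHalf) {k : ℕ}
    (hk : HasInvisibleEvenContact Z (0, 0) k) :
    ∃ φ τ : ℝ → ℝ, AnalyticAt ℝ φ 0 ∧ AnalyticAt ℝ τ 0 ∧ φ 0 = 0 ∧ τ 0 = 0 ∧ deriv φ 0 = -1 ∧
      deriv τ 0 = -2 / (Z (0, 0)).1 ∧ ∀ᶠ x in 𝓝 0, x ≠ 0 →
        ∀ t ξ : ℝ, IsHalfReturn Z x t ξ ↔ t = τ x ∧ ξ = φ x := by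
  have hP := fst_ne_zero_of_hasInvisibleEvenContact hk
  have hzero : ((0 : ℝ), (0 : ℝ)) ∈ upperHalf := le_refl (0 : ℝ)
  obtain ⟨g, hg0, hgZ, hg⟩ := analyticWithinAt_iff_exists_analyticAt'.1 (hZ _ hzero)
  rw [insert_eq_of_mem hzero] at hgZ
  obtain ⟨K, B', hB', hK⟩ := ContDiffAt.exists_lipschitzOnWith (hg.contDiffAt (n := 1))
  obtain ⟨B, hBB', hB, h0B⟩ := mem_nhds_iff.1 hB'
  obtain ⟨Φ, hΦ, hΦ0, hΦd⟩ := exists_analyticAt_flow hg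
  let ι : ℝ × ℝ → ℝ × (ℝ × ℝ) := fun q => (q.1, (0, q.2))
  have hι : AnalyticAt ℝ ι (0, 0) := analyticAt_fst.prod (analyticAt_const.prod analyticAt_snd)
  have hιt : Tendsto ι (𝓝 (0, 0)) (𝓝 (0, (0, 0))) := hι.continuousAt
  let Ψ : ℝ × ℝ → ℝ × ℝ := fun q => Φ (ι q)
  have hΨ : AnalyticAt ℝ Ψ (0, 0) := hΦ.comp (f := ι) hι
  have hΨ0 : ∀ᶠ c in 𝓝 (0 : ℝ), Ψ (0, c) = (0, c) :=
    Tendsto.eventually (f := fun c : ℝ => ((0 : ℝ), c))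
      ((continuous_const.prodMk continuous_id).tendsto 0) hΦ0
  have hΨ00 : Ψ (0, 0) = (0, 0) := hΨ0.self_of_nhds
  have hΨd : ∀ᶠ q in 𝓝 ((0 : ℝ), (0 : ℝ)),
      HasDerivAt (fun s => Ψ (s, q.2)) (g (Ψ q)) q.1 := hιt.eventually hΦd
  have hΨB : ∀ᶠ q in 𝓝 ((0 : ℝ), (0 : ℝ)), Ψ q ∈ B :=
    hΨ.continuousAt.eventually (by rw [hΨ00]; exact hB.mem_nhds h0B)
  -- the orbit through the origin
  have hin1 : AnalyticAt ℝ (fun t : ℝ => (t, (0 : ℝ))) 0 := analyticAt_id.prod analyticAt_const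
  have hlie (i : ℕ) : (lieDeriv Z)^[i] Prod.snd (0, 0) = (openLieDeriv g)^[i] Prod.snd (0, 0) :=
    EventuallyEq.eq_of_nhdsWithin (eventuallyEq_iterate_lieDeriv hg
      (eventually_mem_nhdsWithin.mono hgZ) i) hzero
  obtain ⟨v, hv, hv0, hyv⟩ := exists_height_eq_pow_mul (g := g) (ζ := fun t => Ψ (t, 0))
    (n := 2 * k) (by rw [hΨ00]; exact hg) (hΨ.comp (f := fun t : ℝ => (t, (0 : ℝ))) hin1)
    (hin1.continuousAt.eventually hΨd)
    (fun i hi => by rw [hΨ00, ← hlie]; exact hk.2.1.1 i hi)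
    (by rw [hΨ00, ← hlie]; exact hk.2.2)
  obtain ⟨C, hC, hC0, hCz, δ₁, hδ₁, hcmp⟩ := exists_zero_curve (F := fun q => (Ψ q).2)
    (analyticAt_snd.comp hΨ) (hΨ0.mono fun c hc => by rw [hc])
  have hCsmall : ∀ ρ > 0, ∀ᶠ t in 𝓝 0, |C t| < ρ := fun ρ hρ => by
    have := hC.continuousAt.eventually (Metric.ball_mem_nhds _ hρ)
    simpa [hC0] using this
  have habs : ∀ ρ > 0, ∀ᶠ t in 𝓝 (0 : ℝ), |t| < ρ := fun ρ hρ => by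
    filter_upwards [Metric.ball_mem_nhds (0 : ℝ) hρ] with t ht
    simpa using ht
  obtain ⟨w, hw, hw0, hCw⟩ := exists_eq_pow_mul_of_comparable hC hv hv0 hyv (by
    filter_upwards [hCz, hCsmall δ₁ hδ₁, habs δ₁ hδ₁] with t h1 h2 h3
    have h4 := hcmp t 0 (C t) h3 (by simpa using hδ₁) h2
    rw [h1] at h4
    simpa using h4)
  have hk2 : 2 * k ≠ 0 := by have := hk.1; omega
  obtain ⟨σ, hσ, hσ0, hσ', hCσ⟩ := exists_pow_eq hk2 hw hw0 hCw
  obtain ⟨j, hj, hj0, hj', hσj⟩ := exists_analyticAt_involution hσ hσ0 hσ'.ne'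
  -- the abscissa of the crossing with the switching line
  have hcurve : AnalyticAt ℝ (fun t => (t, C t)) 0 := analyticAt_id.prod hC
  let X : ℝ → ℝ := fun t => (Ψ (t, C t)).1
  have hΨc : AnalyticAt ℝ Ψ (0, C 0) := by rw [hC0]; exact hΨ
  have hX : AnalyticAt ℝ X 0 :=
    analyticAt_fst.comp (hΨc.comp (f := fun t => (t, C t)) hcurve)
  have hX0 : X 0 = 0 := by simp only [X, hC0, hΨ00]
  -- At time `0` a change of label moves the point vertically, so `C'(0)` does not contribute to the
  -- abscissa.
  have hX' : deriv X 0 = (Z (0, 0)).1 := by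
    have hL : HasFDerivAt Ψ (fderiv ℝ Ψ (0, 0)) (0, C 0) := by
      rw [hC0]; exact hΨ.differentiableAt.hasFDerivAt
    have hL0 : HasFDerivAt Ψ (fderiv ℝ Ψ (0, 0)) (0, 0) := hΨ.differentiableAt.hasFDerivAt
    have d1 : HasDerivAt (fun t => (t, C t)) (1, deriv C 0) 0 :=
      (hasDerivAt_id' (0 : ℝ)).prodMk hC.differentiableAt.hasDerivAt
    have d2 : HasDerivAt (fun t : ℝ => (t, (0 : ℝ))) (1, 0) 0 :=
      (hasDerivAt_id' (0 : ℝ)).prodMk (hasDerivAt_const (0 : ℝ) (0 : ℝ))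
    have d3 : HasDerivAt (fun c : ℝ => ((0 : ℝ), c)) (0, 1) 0 :=
      (hasDerivAt_const (0 : ℝ) (0 : ℝ)).prodMk (hasDerivAt_id' (0 : ℝ))
    have h1 : HasDerivAt (fun t => Ψ (t, C t)) (fderiv ℝ Ψ (0, 0) (1, deriv C 0)) 0 :=
      hL.comp_hasDerivAt (f := fun t => (t, C t)) 0 d1
    have h2 : HasDerivAt (fun t : ℝ => Ψ (t, 0)) (fderiv ℝ Ψ (0, 0) (1, 0)) 0 :=
      hL0.comp_hasDerivAt (f := fun t : ℝ => (t, (0 : ℝ))) 0 d2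
    have h3 : HasDerivAt (fun c : ℝ => Ψ (0, c)) (fderiv ℝ Ψ (0, 0) (0, 1)) 0 :=
      hL0.comp_hasDerivAt (f := fun c : ℝ => ((0 : ℝ), c)) 0 d3
    have h4 : fderiv ℝ Ψ (0, 0) (1, 0) = Z (0, 0) := by
      have := h2.unique hΨd.self_of_nhds
      rw [this, hΨ00, hg0]
    have h5 : fderiv ℝ Ψ (0, 0) (0, 1) = (0, 1) :=
      h3.unique (d3.congr_of_eventuallyEq hΨ0)
    have h6 : ((1 : ℝ), deriv C 0) = (1, 0) + deriv C 0 • ((0 : ℝ), (1 : ℝ)) := by simp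
    have h7 : HasDerivAt X (fderiv ℝ Ψ (0, 0) (1, deriv C 0)).1 0 :=
      HasFDerivAt.comp_hasDerivAt (f := fun t => Ψ (t, C t)) 0 hasFDerivAt_fst h1
    rw [h7.deriv, h6, map_add, map_smul, h4, h5]
    simp
  obtain ⟨r, hr, hr0, hr', -, hXr⟩ := exists_analyticAt_inverse hX hX0 (by rwa [hX'])
  rw [hX'] at hr'
  have hjr : AnalyticAt ℝ j (r 0) := by rw [hr0]; exact hj
  have hj2 : AnalyticAt ℝ (fun x => j (r x)) 0 := hjr.comp (f := r) hr
  have hj20 : j (r 0) = 0 := by rw [hr0, hj0]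
  have hj2' : HasDerivAt (fun x => j (r x)) (-(Z (0, 0)).1⁻¹) 0 := by
    have h1 : HasDerivAt j (-1) (r 0) := by
      rw [hr0, ← hj']; exact hj.differentiableAt.hasDerivAt
    have h2 : HasDerivAt r (Z (0, 0)).1⁻¹ 0 := by
      rw [← hr']; exact hr.differentiableAt.hasDerivAt
    have := h1.comp (0 : ℝ) h2
    rwa [neg_one_mul] at this
  have hXj : AnalyticAt ℝ X (j (r 0)) := by rw [hj20]; exact hX
  -- The orbit through `(x, 0)` is there at time `r x` and meets Σ again at time `j (r x)`.
  refine ⟨fun x => X (j (r x)), fun x => j (r x) - r x,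
    hXj.comp (f := fun x => j (r x)) hj2, hj2.sub hr, by simp [hj20, hX0], by simp [hr0, hj0],
    ?_, ?_, ?_⟩
  · have h1 : HasDerivAt X (Z (0, 0)).1 (j (r 0)) := by
      rw [hj20, ← hX']; exact hX.differentiableAt.hasDerivAt
    have h2 := (h1.comp (0 : ℝ) hj2').deriv
    rw [mul_neg, mul_inv_cancel₀ hP] at h2
    exact h2
  · have h2 : HasDerivAt r (Z (0, 0)).1⁻¹ 0 := by
      rw [← hr']; exact hr.differentiableAt.hasDerivAt
    have h3 := (hj2'.sub h2).deriv
    refine Eq.trans h3 ?_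
    field_simp
    norm_num
  · obtain ⟨δ₂, hδ₂, hbox⟩ := Metric.eventually_nhds_iff.1 (hΨd.and hΨB)
    -- Labels are bounded by `ε` and times by `δ`, chosen so that `C` sends these times to
    -- admissible labels.
    set ε := min δ₁ δ₂ with hε
    have hε0 : 0 < ε := lt_min hδ₁ hδ₂
    obtain ⟨δ₃, hδ₃, hmono⟩ := exists_strictMonoOn_of_deriv_pos hσ hσ'
    obtain ⟨δ₄, hδ₄, hCall⟩ := Metric.eventually_nhds_iff.1
      ((hCsmall ε hε0).and (hCz.and hCσ))
    set δ := min ε (min δ₃ δ₄) with hδ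
    have hδ0 : 0 < δ := lt_min hε0 (lt_min hδ₃ hδ₄)
    have hδε : δ ≤ ε := min_le_left _ _
    have hδ3 : δ ≤ δ₃ := (min_le_right _ _).trans (min_le_left _ _)
    have hδ4 : δ ≤ δ₄ := (min_le_right _ _).trans (min_le_right _ _)
    have hε1 : ε ≤ δ₁ := min_le_left _ _
    have hε2 : ε ≤ δ₂ := min_le_right _ _
    have hrt : Tendsto r (𝓝 0) (𝓝 0) := by simpa [hr0] using hr.continuousAt.tendsto
    have hjt : Tendsto (fun x => j (r x)) (𝓝 0) (𝓝 0) := by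
      simpa [hr0, hj0] using hj2.continuousAt.tendsto
    filter_upwards [hXr, hrt.eventually (habs δ hδ0), hjt.eventually (habs δ hδ0),
      hrt.eventually hσj] with x h1 h2 h3 h4 hx t ξ
    have h5 := isHalfReturn_iff_of_flow hZ hB (fun p _ hp => (hgZ hp).symm) (hK.mono hBB')
      (Ψ := Ψ) (C := C) (σ := σ) (k := k) (by omega) (δ := δ) (ε := ε)
      (fun t c ht hc => hbox (y := (t, c)) (by
        simp only [Prod.dist_eq, dist_zero_right, Real.norm_eq_abs, max_lt_iff]
        exact ⟨ht.trans_le (hδε.trans hε2), hc.trans_le hε2⟩))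
      (fun t c c' ht hc hc' => hcmp t c c' (ht.trans_le (hδε.trans hε1)) (hc.trans_le hε1)
        (hc'.trans_le hε1))
      (fun t ht => hCall (y := t) (by
        rw [dist_zero_right]; exact ht.trans_le hδ4))
      (hmono.mono (Ioo_subset_Ioo (neg_le_neg hδ3) hδ3)) hσ0 h2 h3
      (fun h => hx (by rw [← h1, h, hX0])) h4 t ξ
    have h6 : (Ψ (r x, C (r x))).1 = x := h1
    rw [h6] at h5
    exact h5

end HalfMonodromy

theorem mainTheorem7 (Z : ℝ × ℝ → ℝ × ℝ)
    (hZ : AnalyticOn ℝ Z HalfMonodromy.upperHalf)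
    (k : ℕ) (hk : HalfMonodromy.HasInvisibleEvenContact Z (0, 0) k) :
    ∃ x₀ : ℝ, 0 < x₀ ∧ ∃ φ τ : ℝ → ℝ, ∃ α T : ℕ → ℝ,
      -- `φ` is the half-return map and `τ` the flight time: for `0 < x < x₀` the orbit of `(x, 0)`
      -- has exactly one half-turn, it takes the time `τ x` and it ends at `(φ x, 0)`, `φ x < 0`
      (∀ x ∈ Set.Ioo 0 x₀, φ x < 0 ∧
        ∀ t ξ : ℝ, HalfMonodromy.IsHalfReturn Z x t ξ ↔ t = τ x ∧ ξ = φ x) ∧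
      -- both are analytic, up to and including `x = 0`
      AnalyticOnNhd ℝ φ (Set.Ioo (-x₀) x₀) ∧
      AnalyticOnNhd ℝ τ (Set.Ioo (-x₀) x₀) ∧
      -- their expansions
      (∀ x ∈ Set.Ioo (-x₀) x₀,
        Summable (fun i : ℕ => α (i + 2) * x ^ (i + 2)) ∧
        φ x = -x - ∑' i : ℕ, α (i + 2) * x ^ (i + 2)) ∧
      (∀ x ∈ Set.Ioo (-x₀) x₀,
        Summable (fun i : ℕ => T (i + 1) * x ^ (i + 2)) ∧
        τ x = T 0 * x + ∑' i : ℕ, T (i + 1) * x ^ (i + 2)) ∧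
      T 0 * (Z (0, 0)).1 < 0 := by
  have hP := HalfMonodromy.fst_ne_zero_of_hasInvisibleEvenContact hk
  obtain ⟨φ, τ, hφ, hτ, hφ0, hτ0, hφ', hτ', hret⟩ :=
    HalfMonodromy.exists_analyticAt_halfReturn hZ hk
  obtain ⟨ρ₁, hρ₁, a, ha⟩ := HalfMonodromy.exists_power_series_of_analyticAt hφ hφ0
  obtain ⟨ρ₂, hρ₂, b, hb⟩ := HalfMonodromy.exists_power_series_of_analyticAt hτ hτ0
  -- Since `-φ` vanishes at `0` with derivative `1`, it is positive just to the right of `0`.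
  obtain ⟨ρ₃, hρ₃, hmono⟩ := HalfMonodromy.exists_strictMonoOn_of_deriv_pos (σ := fun x => -φ x)
    hφ.neg (by rw [deriv.fun_neg, hφ']; norm_num)
  obtain ⟨ρ₄, hρ₄, hall⟩ := Metric.eventually_nhds_iff.1
    (hret.and (hφ.eventually_analyticAt.and hτ.eventually_analyticAt))
  set x₀ := min (min ρ₁ ρ₂) (min ρ₃ ρ₄) with hx₀
  have h1 : x₀ ≤ ρ₁ := (min_le_left _ _).trans (min_le_left _ _)
  have h2 : x₀ ≤ ρ₂ := (min_le_left _ _).trans (min_le_right _ _)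
  have h3 : x₀ ≤ ρ₃ := (min_le_right _ _).trans (min_le_left _ _)
  have h4 : x₀ ≤ ρ₄ := (min_le_right _ _).trans (min_le_right _ _)
  have hx₀pos : 0 < x₀ := lt_min (lt_min hρ₁ hρ₂) (lt_min hρ₃ hρ₄)
  have hdist {x : ℝ} (hx : x ∈ Ioo (-x₀) x₀) : dist x 0 < ρ₄ := by
    rw [dist_zero_right]
    exact (abs_lt.2 hx).trans_le h4
  -- Indices of `T` are one below the power of `x`, hence the shift in `b`; the linear coefficient
  -- is `deriv τ 0`.
  refine ⟨x₀, hx₀pos, φ, τ, fun i => -a i,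
    fun i => if i = 0 then deriv τ 0 else b (i + 1), ?_, ?_, ?_, ?_, ?_, ?_⟩
  · intro x hx
    have hx' : x ∈ Ioo (-x₀) x₀ := ⟨by linarith [hx.1], hx.2⟩
    refine ⟨?_, (hall (hdist hx')).1 hx.1.ne'⟩
    have := hmono (a := 0) (b := x) ⟨by linarith, hρ₃⟩
      ⟨by linarith [hx.1], hx.2.trans_le h3⟩ hx.1
    simp only [hφ0] at this
    linarith
  · exact fun x hx => (hall (hdist hx)).2.1
  · exact fun x hx => (hall (hdist hx)).2.2
  · intro x hx
    obtain ⟨hs, he⟩ := ha x ⟨by linarith [hx.1], hx.2.trans_le h1⟩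
    simp only [neg_mul]
    refine ⟨hs.neg, ?_⟩
    rw [he, hφ', tsum_neg]
    ring
  · intro x hx
    obtain ⟨hs, he⟩ := hb x ⟨by linarith [hx.1], hx.2.trans_le h2⟩
    simpa using ⟨hs, he⟩
  · simp only [if_true, hτ']
    rw [div_mul_cancel₀ _ hP]
    norm_num
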